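/- Let $F_1,\dots,F_n$ be a finite family $\mathcal F$ of nonempty convex sets in the plane $\mathbb R^2$ (repetitions are allowed and counted with multiplicity) such that for any three members $A,B,C$ of $\mathcal F$ with pairwise distinct indices, $$\operatorname{conv}(A\cup B)\cap\operatorname{conv}(B\cup C)\cap\operatorname{conv}(C\cup A)\neq\emptyset .$$ Then there is a line $\ell\subset\mathbb R^2$ that meets at least $\frac18|\mathcal F| = \frac n8$ members of $\mathcal F$. -/

import Mathlib

/-- The Euclidean plane. -/
abbrev Plane : Type := EuclideanSpace ℝ (Fin 2)

/-- A line in the plane: a one-dimensional affine subspace. -/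
def IsLine (l : AffineSubspace ℝ Plane) : Prop :=
  (l : Set Plane).Nonempty ∧ Module.finrank ℝ l.direction = 1

/-- The line `l` is transversal to the set `A`, that is, it meets `A`. -/
def IsTransversal (l : AffineSubspace ℝ Plane) (A : Set Plane) : Prop :=
  ((l : Set Plane) ∩ A).Nonempty

/-! After shrinking to compact sets, Helly's theorem yields a point O in the hull of every majority
subfamily: three majorities share a member, or meet pairwise in three distinct members, which are
tight. Hence an open half-plane with O on its boundary contains at most n/2 members.

Suppose every line meets fewer than n/8 members. The horizontal line through O leaves more than 7n/8
of them, in families U above and L below, and each becomes an interval of parameters t of lines x +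
t y = 0 centred at O. Tightness forbids disjoint intervals alternating as U, L, U or L, U, L. For a
suitable t with members of both families strictly on both sides, the left parts of U and L therefore
cross-intersect, and so do the right parts. One part of each pair has a common parameter, hence
fewer than n/8 members. With the line t this accounts for less than 3n/8; the two other parts lie in
one half-plane at O, which adds at most n/2. The total falls below 7n/8
(`intervals_two_sides_false`). -/

/-- Two nonempty finite families of intervals such that every member of one meets every member of
the other: some point is common to all the members of one of the families. -/
theorem exists_mem_all_of_cross_intersecting {ι : Type*} (S T : Finset ι) (α β : ι → ℝ)
    (hS : S.Nonempty)
    (h₁ : ∀ i ∈ S, ∀ j ∈ T, α i ≤ β j) (h₂ : ∀ i ∈ S, ∀ j ∈ T, α j ≤ β i) :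
    ∃ t, (∀ i ∈ S, α i ≤ t ∧ t ≤ β i) ∨ (∀ j ∈ T, α j ≤ t ∧ t ≤ β j) := by
  -- The common point is the smallest right endpoint over both families; it serves the family that
  -- does not own it.
  obtain ⟨s, hs, hmin⟩ := S.exists_min_image β hS
  by_cases h : ∀ j ∈ T, β s ≤ β j
  · exact ⟨β s, Or.inr fun j hj => ⟨h₂ s hs j hj, h j hj⟩⟩
  · push Not at h
    obtain ⟨j₁, hj₁, hlt₁⟩ := h
    obtain ⟨j, hj, hjm⟩ := T.exists_min_image β ⟨j₁, hj₁⟩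
    have hlt : β j < β s := (hjm j₁ hj₁).trans_lt hlt₁
    exact ⟨β j, Or.inl fun i hi => ⟨h₁ i hi j hj, hlt.le.trans (hmin i hi)⟩⟩

-- Sets above and below O with parameters on the same side of t lie on opposite sides of the line t,
-- hence the crossed pairs in `h₁` and `h₂`.
open Finset in
theorem intervals_two_sides_false {ι : Type*} [DecidableEq ι] (n : ℕ) (U L : Finset ι)
    (α β : ι → ℝ) (hα : ∀ i ∈ U ∪ L, α i ≤ β i)
    (hU : 2 * #U ≤ n) (hL : 2 * #L ≤ n) (hUL : 7 * n < 8 * (#U + #L))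
    (h₁ : ∀ t, 2 * (#{i ∈ U | β i < t} + #{i ∈ L | t < α i}) ≤ n)
    (h₂ : ∀ t, 2 * (#{i ∈ U | t < α i} + #{i ∈ L | β i < t}) ≤ n)
    (hhit : ∀ t, 8 * (#{i ∈ U | α i ≤ t ∧ t ≤ β i} + #{i ∈ L | α i ≤ t ∧ t ≤ β i}) < n)
    (hULU : ∀ a ∈ U, ∀ c ∈ L, ∀ b ∈ U, β a < α c → β c < α b → False)
    (hLUL : ∀ a ∈ L, ∀ c ∈ U, ∀ b ∈ L, β a < α c → β c < α b → False) : False := by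
  have split : ∀ (V : Finset ι) (t : ℝ), (∀ i ∈ V, α i ≤ β i) →
      #V = #{i ∈ V | β i < t} + #{i ∈ V | t < α i} + #{i ∈ V | α i ≤ t ∧ t ≤ β i} := by
    intro V t hV
    rw [← card_union_of_disjoint, ← card_union_of_disjoint]
    · congr 1
      ext i
      simp only [mem_union, mem_filter]
      have := le_or_gt (α i) t
      have := le_or_gt t (β i)
      tauto
    · rw [disjoint_left]
      intro i hi hi'
      simp only [mem_union, mem_filter] at hi hi'
      rcases hi with hi | hi
      · linarith [hi.2, hi'.2.2]
      · linarith [hi.2, hi'.2.1]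
    · rw [disjoint_left]
      intro i hi hi'
      simp only [mem_filter] at hi hi'
      linarith [hi.2, hi'.2, hV i hi.1]
  have hαU : ∀ i ∈ U, α i ≤ β i := fun i hi => hα i (mem_union_left _ hi)
  have hαL : ∀ i ∈ L, α i ≤ β i := fun i hi => hα i (mem_union_right _ hi)
  have hUne : U.Nonempty := card_pos.1 (by omega)
  have hLne : L.Nonempty := card_pos.1 (by omega)
  obtain ⟨a, ha, hamin⟩ := U.exists_min_image β hUne
  obtain ⟨c, hc, hcmin⟩ := L.exists_min_image β hLne
  -- Just past θ both families have a member on the left, while at θ one left part is still empty.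
  -- That emptiness and the bounds n/2 force both right parts to exceed n/4.
  obtain ⟨θ, hθa, hθc, hθ⟩ : ∃ θ, β a ≤ θ ∧ β c ≤ θ ∧ (θ = β a ∨ θ = β c) :=
    ⟨max (β a) (β c), le_max_left _ _, le_max_right _ _, max_choice _ _⟩
  have hpos : 0 < #{i ∈ U | θ < α i} ∧ 0 < #{i ∈ L | θ < α i} := by
    have e : #{i ∈ U | β i < θ} = 0 ∨ #{i ∈ L | β i < θ} = 0 := by
      rcases hθ with rfl | rfl
      · left
        rw [card_eq_zero, filter_eq_empty_iff]
        exact fun i hi => not_lt.2 (hamin i hi)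
      · right
        rw [card_eq_zero, filter_eq_empty_iff]
        exact fun i hi => not_lt.2 (hcmin i hi)
    have := split U θ hαU
    have := split L θ hαL
    have := hhit θ
    have := h₁ θ
    have := h₂ θ
    omega
  obtain ⟨b, hb⟩ := card_pos.1 hpos.1
  obtain ⟨d, hd⟩ := card_pos.1 hpos.2
  rw [mem_filter] at hb hd
  obtain ⟨t, htθ, htb, htd⟩ : ∃ t, θ < t ∧ t < α b ∧ t < α d := by
    obtain ⟨t, h, h'⟩ := exists_between (lt_min hb.2 hd.2)
    exact ⟨t, h, h'.trans_le (min_le_left _ _), h'.trans_le (min_le_right _ _)⟩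
  have hat : β a < t := hθa.trans_lt htθ
  have hct : β c < t := hθc.trans_lt htθ
  have few : ∀ S T : Finset ι, S ⊆ U → T ⊆ L → S.Nonempty →
      (∀ i ∈ S, ∀ j ∈ T, α i ≤ β j) → (∀ i ∈ S, ∀ j ∈ T, α j ≤ β i) →
      8 * #S < n ∨ 8 * #T < n := by
    intro S T hS hT hne k₁ k₂
    obtain ⟨p, hp | hp⟩ := exists_mem_all_of_cross_intersecting S T α β hne k₁ k₂
    · left
      have : #S ≤ #{i ∈ U | α i ≤ p ∧ p ≤ β i} := card_le_card fun i hi =>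
        mem_filter.2 ⟨hS hi, hp i hi⟩
      have := hhit p
      omega
    · right
      have : #T ≤ #{i ∈ L | α i ≤ p ∧ p ≤ β i} := card_le_card fun i hi =>
        mem_filter.2 ⟨hT hi, hp i hi⟩
      have := hhit p
      omega
  -- Two disjoint left intervals from different families would form a forbidden alternation with `b`
  -- or `d`, which lie right of t.
  have e₁ := few {i ∈ U | β i < t} {i ∈ L | β i < t} (filter_subset _ _) (filter_subset _ _)
    ⟨a, mem_filter.2 ⟨ha, hat⟩⟩
    (fun i hi j hj => by
      rw [mem_filter] at hi hj
      exact not_lt.1 fun h => hLUL j hj.1 i hi.1 d hd.1 h (hi.2.trans htd))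
    (fun i hi j hj => by
      rw [mem_filter] at hi hj
      exact not_lt.1 fun h => hULU i hi.1 j hj.1 b hb.1 h (hj.2.trans htb))
  have e₂ := few {i ∈ U | t < α i} {i ∈ L | t < α i} (filter_subset _ _) (filter_subset _ _)
    ⟨b, mem_filter.2 ⟨hb.1, htb⟩⟩
    (fun i hi j hj => by
      rw [mem_filter] at hi hj
      exact not_lt.1 fun h => hULU a ha j hj.1 i hi.1 (hat.trans hj.2) h)
    (fun i hi j hj => by
      rw [mem_filter] at hi hj
      exact not_lt.1 fun h => hLUL c hc i hi.1 j hj.1 (hct.trans hi.2) h)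
  -- Whichever left and right parts are small, the other two make up U, L, or a pair bounded by `h₁`
  -- or `h₂`.
  have := split U t hαU
  have := split L t hαL
  have := hhit t
  have := h₁ t
  have := h₂ t
  omega

/-! ### Reduction to compact sets -/

/-- Every three members of a family with distinct indices form a tight triple. -/
def TightFamily {ι : Type*} (F : ι → Set Plane) : Prop :=
  ∀ i j k : ι, i ≠ j → j ≠ k → k ≠ i →
    (convexHull ℝ (F i ∪ F j) ∩ convexHull ℝ (F j ∪ F k) ∩ convexHull ℝ (F k ∪ F i)).Nonempty

theorem exists_finset_mem_convexHull {s : Set Plane} {x : Plane} (hx : x ∈ convexHull ℝ s) :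
    ∃ t : Finset Plane, (t : Set Plane) ⊆ s ∧ x ∈ convexHull ℝ (t : Set Plane) := by
  rw [convexHull_eq_union_convexHull_finite_subsets] at hx
  simpa only [Set.mem_iUnion, exists_prop] using hx

/-- A finite tight family of convex sets contains a tight family of compact convex sets. -/
theorem exists_compact_tightFamily {ι : Type*} [Finite ι] (F : ι → Set Plane)
    (hconv : ∀ i, Convex ℝ (F i)) (hne : ∀ i, (F i).Nonempty) (hF : TightFamily F) :
    ∃ K : ι → Set Plane, (∀ i, K i ⊆ F i) ∧ (∀ i, Convex ℝ (K i)) ∧ (∀ i, (K i).Nonempty) ∧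
      (∀ i, IsCompact (K i)) ∧ TightFamily K := by
  have key : ∀ q : ι × ι × ι, ∃ t : Set Plane, t.Finite ∧
      (q.1 ≠ q.2.1 → q.2.1 ≠ q.2.2 → q.2.2 ≠ q.1 →
        (convexHull ℝ (t ∩ (F q.1 ∪ F q.2.1)) ∩ convexHull ℝ (t ∩ (F q.2.1 ∪ F q.2.2)) ∩
          convexHull ℝ (t ∩ (F q.2.2 ∪ F q.1))).Nonempty) := by
    rintro ⟨i, j, k⟩
    by_cases h : i ≠ j ∧ j ≠ k ∧ k ≠ i
    · obtain ⟨x, ⟨h₁, h₂⟩, h₃⟩ := hF i j k h.1 h.2.1 h.2.2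
      obtain ⟨t₁, ht₁, hx₁⟩ := exists_finset_mem_convexHull h₁
      obtain ⟨t₂, ht₂, hx₂⟩ := exists_finset_mem_convexHull h₂
      obtain ⟨t₃, ht₃, hx₃⟩ := exists_finset_mem_convexHull h₃
      have hfin := (t₁.finite_toSet.union t₂.finite_toSet).union t₃.finite_toSet
      refine ⟨_, hfin, fun _ _ _ => ⟨x, ⟨convexHull_mono ?_ hx₁, convexHull_mono ?_ hx₂⟩,
        convexHull_mono ?_ hx₃⟩⟩
      · exact fun y hy => ⟨Or.inl (Or.inl hy), ht₁ hy⟩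
      · exact fun y hy => ⟨Or.inl (Or.inr hy), ht₂ hy⟩
      · exact fun y hy => ⟨Or.inr hy, ht₃ hy⟩
    · exact ⟨∅, Set.finite_empty, fun h₁ h₂ h₃ => (h ⟨h₁, h₂, h₃⟩).elim⟩
  choose t htfin ht using key
  choose p hp using hne
  -- Finitely many points witness the tightness of all triples; `p` keeps every trace on T nonempty.
  set T : Set Plane := (⋃ q, t q) ∪ Set.range p with hT
  have hTfin : T.Finite := (Set.finite_iUnion htfin).union (Set.finite_range p)
  refine ⟨fun i => convexHull ℝ (T ∩ F i), fun i => convexHull_min Set.inter_subset_right (hconv i),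
    fun i => convex_convexHull ℝ _,
    fun i => ⟨p i, subset_convexHull ℝ _ ⟨Or.inr ⟨i, rfl⟩, hp i⟩⟩,
    fun i => (hTfin.subset Set.inter_subset_left).isCompact_convexHull (𝕜 := ℝ), ?_⟩
  intro i j k hij hjk hki
  have mono : ∀ a b, convexHull ℝ (t (i, j, k) ∩ (F a ∪ F b)) ⊆
      convexHull ℝ (convexHull ℝ (T ∩ F a) ∪ convexHull ℝ (T ∩ F b)) := by
    intro a b
    refine convexHull_mono ?_
    rintro y ⟨hy, hya | hyb⟩
    · exact Or.inl (subset_convexHull ℝ _ ⟨Or.inl (Set.mem_iUnion.2 ⟨_, hy⟩), hya⟩)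
    · exact Or.inr (subset_convexHull ℝ _ ⟨Or.inl (Set.mem_iUnion.2 ⟨_, hy⟩), hyb⟩)
  obtain ⟨x, ⟨h₁, h₂⟩, h₃⟩ := ht (i, j, k) hij hjk hki
  exact ⟨x, ⟨mono _ _ h₁, mono _ _ h₂⟩, mono _ _ h₃⟩

/-! ### A central point by Helly's theorem -/

/-- A tight family has a point in the convex hull of the union of every subfamily that has more
than half of its members. -/
theorem exists_mem_convexHull_of_majority {ι : Type*} [Fintype ι] (F : ι → Set Plane)
    (hne : ∀ i, (F i).Nonempty) (hF : TightFamily F) :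
    ∃ O : Plane, ∀ G : Finset ι, Fintype.card ι < 2 * G.card →
      O ∈ convexHull ℝ (⋃ i ∈ G, F i) := by
  classical
  have inter : ∀ G H : Finset ι, Fintype.card ι < 2 * G.card → Fintype.card ι < 2 * H.card →
      ∃ i ∈ G, i ∈ H := by
    intro G H hG hH
    have h₁ := Finset.card_union_add_card_inter G H
    have h₂ := Finset.card_le_univ (G ∪ H)
    obtain ⟨i, hi⟩ := Finset.card_pos.1 (show 0 < (G ∩ H).card by omega)
    exact ⟨i, Finset.mem_inter.1 hi⟩
  have pair : ∀ (G : Finset ι) (i j : ι), i ∈ G → j ∈ G →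
      convexHull ℝ (F i ∪ F j) ⊆ convexHull ℝ (⋃ i ∈ G, F i) := fun G i j hi hj =>
    convexHull_mono (Set.union_subset (Set.subset_biUnion_of_mem (u := F) hi)
      (Set.subset_biUnion_of_mem (u := F) hj))
  have three : ∀ G₁ G₂ G₃ : Finset ι, Fintype.card ι < 2 * G₁.card →
      Fintype.card ι < 2 * G₂.card → Fintype.card ι < 2 * G₃.card →
      ∃ x, x ∈ convexHull ℝ (⋃ i ∈ G₁, F i) ∧ x ∈ convexHull ℝ (⋃ i ∈ G₂, F i) ∧
        x ∈ convexHull ℝ (⋃ i ∈ G₃, F i) := by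
    intro G₁ G₂ G₃ h₁ h₂ h₃
    by_cases h : ∃ i, i ∈ G₁ ∧ i ∈ G₂ ∧ i ∈ G₃
    · obtain ⟨i, i₁, i₂, i₃⟩ := h
      obtain ⟨x, hx⟩ := hne i
      have hx' : x ∈ convexHull ℝ (F i ∪ F i) := subset_convexHull ℝ _ (Or.inl hx)
      exact ⟨x, pair _ i i i₁ i₁ hx', pair _ i i i₂ i₂ hx', pair _ i i i₃ i₃ hx'⟩
    · obtain ⟨i, i₁, i₂⟩ := inter G₁ G₂ h₁ h₂
      obtain ⟨j, j₂, j₃⟩ := inter G₂ G₃ h₂ h₃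
      obtain ⟨k, k₃, k₁⟩ := inter G₃ G₁ h₃ h₁
      obtain ⟨x, ⟨x₁, x₂⟩, x₃⟩ := hF i j k (by rintro rfl; exact h ⟨i, i₁, i₂, j₃⟩)
        (by rintro rfl; exact h ⟨j, k₁, j₂, j₃⟩) (by rintro rfl; exact h ⟨k, k₁, i₂, k₃⟩)
      exact ⟨x, pair _ _ _ k₁ i₁ x₃, pair _ _ _ i₂ j₂ x₁, pair _ _ _ j₃ k₃ x₂⟩
  have helly := Convex.helly_theorem' (𝕜 := ℝ) (E := Plane)
    (F := fun G : Finset ι => convexHull ℝ (⋃ i ∈ G, F i))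
    (s := Finset.univ.filter fun G : Finset ι => Fintype.card ι < 2 * G.card)
    (fun _ _ => convex_convexHull ℝ _) (by
      intro I hI hcard
      rw [finrank_euclideanSpace_fin] at hcard
      have hI' : ∀ G ∈ I, Fintype.card ι < 2 * G.card := fun G hG =>
        (Finset.mem_filter.1 (hI hG)).2
      rcases I.eq_empty_or_nonempty with rfl | ⟨G₁, hG₁⟩
      · exact ⟨0, by simp⟩
      obtain ⟨G₂, hG₂, G₃, hG₃, hsub⟩ : ∃ G₂ ∈ I, ∃ G₃ ∈ I, ∀ G ∈ I, G = G₁ ∨ G = G₂ ∨ G = G₃ := by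
        rcases (I.erase G₁).eq_empty_or_nonempty with h | ⟨G₂, hG₂⟩
        · refine ⟨G₁, hG₁, G₁, hG₁, fun G hG => Or.inl ?_⟩
          by_contra hne
          exact Finset.notMem_empty G (h ▸ Finset.mem_erase.2 ⟨hne, hG⟩)
        have hG₂I := Finset.mem_of_mem_erase hG₂
        rcases ((I.erase G₁).erase G₂).eq_empty_or_nonempty with h | ⟨G₃, hG₃⟩
        · refine ⟨G₂, hG₂I, G₂, hG₂I, fun G hG => ?_⟩
          by_contra! hne
          exact Finset.notMem_empty G
            (h ▸ Finset.mem_erase.2 ⟨hne.2.1, Finset.mem_erase.2 ⟨hne.1, hG⟩⟩)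
        refine ⟨G₂, hG₂I, G₃, Finset.mem_of_mem_erase (Finset.mem_of_mem_erase hG₃),
          fun G hG => ?_⟩
        by_contra! hne
        have h₁ := Finset.card_erase_of_mem hG₁
        have h₂ := Finset.card_erase_of_mem hG₂
        have h₃ := Finset.card_erase_of_mem hG₃
        have h₄ : 0 < (((I.erase G₁).erase G₂).erase G₃).card := Finset.card_pos.2 ⟨G, by
          simp only [Finset.mem_erase]
          exact ⟨hne.2.2, hne.2.1, hne.1, hG⟩⟩
        omega
      obtain ⟨x, x₁, x₂, x₃⟩ := three G₁ G₂ G₃ (hI' _ hG₁) (hI' _ hG₂) (hI' _ hG₃)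
      refine ⟨x, Set.mem_iInter₂.2 fun G hG => ?_⟩
      rcases hsub G hG with rfl | rfl | rfl
      exacts [x₁, x₂, x₃])
  obtain ⟨O, hO⟩ := helly
  exact ⟨O, fun G hG => Set.mem_iInter₂.1 hO G (by simpa using hG)⟩

/-! ### Lines through the central point -/

/-- The affine form with linear part `(a, b)` that vanishes at `O`. -/
def formAt (O : Plane) (a b : ℝ) (p : Plane) : ℝ := a * (p 0 - O 0) + b * (p 1 - O 1)

theorem formAt_combo (O : Plane) (a b : ℝ) (p q : Plane) {s t : ℝ} (hst : s + t = 1) :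
    formAt O a b (s • p + t • q) = s * formAt O a b p + t * formAt O a b q := by
  obtain rfl : t = 1 - s := by linarith
  simp only [formAt, PiLp.add_apply, PiLp.smul_apply, smul_eq_mul]
  ring

theorem continuous_formAt (O : Plane) (a b : ℝ) : Continuous (formAt O a b) := by
  unfold formAt
  fun_prop

theorem convex_formAt_pos (O : Plane) (a b : ℝ) : Convex ℝ {p | 0 < formAt O a b p} := by
  intro p hp q hq s t hs ht hst
  simp only [Set.mem_ofPred_eq] at hp hq ⊢
  rw [formAt_combo _ _ _ _ _ hst]
  rcases hs.eq_or_lt with rfl | hs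
  · obtain rfl : t = 1 := by linarith
    linarith
  · have := mul_pos hs hp
    have := mul_nonneg ht hq.le
    linarith

theorem convex_formAt_nonneg (O : Plane) (a b : ℝ) : Convex ℝ {p | 0 ≤ formAt O a b p} := by
  intro p hp q hq s t hs ht hst
  simp only [Set.mem_ofPred_eq] at hp hq ⊢
  rw [formAt_combo _ _ _ _ _ hst]
  have := mul_nonneg hs hp
  have := mul_nonneg ht hq
  linarith

theorem exists_formAt_eq_zero (O : Plane) (a b : ℝ) {s : Set Plane} (hs : Convex ℝ s) {p q : Plane}
    (hp : p ∈ s) (hq : q ∈ s) (hp0 : 0 ≤ formAt O a b p) (hq0 : formAt O a b q ≤ 0) :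
    ∃ z ∈ s, formAt O a b z = 0 := by
  obtain ⟨z, hz, h⟩ := hs.isPreconnected.intermediate_value hq hp
    (continuous_formAt O a b).continuousOn ⟨hq0, hp0⟩
  exact ⟨z, hz, h⟩

/-- The zero set of a nonconstant affine form on the plane lies on a line. -/
theorem exists_isLine_of_formAt (O : Plane) (a b : ℝ) (hab : a ≠ 0 ∨ b ≠ 0) :
    ∃ l : AffineSubspace ℝ Plane, IsLine l ∧ ∀ p, formAt O a b p = 0 → p ∈ l := by
  have hpos : 0 < a ^ 2 + b ^ 2 := by
    rcases hab with h | h <;> positivity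
  refine ⟨AffineSubspace.mk' O (Submodule.span ℝ {(!₂[-b, a] : Plane)}),
    ⟨⟨O, AffineSubspace.self_mem_mk' _ _⟩, ?_⟩, fun p hp => ?_⟩
  · rw [AffineSubspace.direction_mk']
    refine finrank_span_singleton fun h => ?_
    have h0 := congrArg (fun v : Plane => v 0) h
    have h1 := congrArg (fun v : Plane => v 1) h
    simp at h0 h1
    simp [h0, h1] at hpos
  · rw [AffineSubspace.mem_mk', Submodule.mem_span_singleton]
    unfold formAt at hp
    refine ⟨(a * (p 1 - O 1) - b * (p 0 - O 0)) / (a ^ 2 + b ^ 2), ?_⟩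
    ext i
    fin_cases i
    · simp
      field_simp
      linear_combination (-a) * hp
    · simp
      field_simp
      linear_combination (-b) * hp

/-- Three sets in alternate sectors of three concurrent lines do not form a tight triple. -/
theorem not_tight_of_alternate_sectors (O : Plane) (σ s r : ℝ) (hsr : s < r) (A B C : Set Plane)
    (hA : ∀ p ∈ A, 0 < formAt O 0 σ p) (hB : ∀ p ∈ B, 0 < formAt O 0 σ p)
    (hA' : ∀ p ∈ A, 0 ≤ formAt O σ (σ * s) p) (hC : ∀ p ∈ C, 0 ≤ formAt O σ (σ * s) p)
    (hC' : ∀ p ∈ C, 0 ≤ formAt O (-σ) (-σ * r) p) (hB' : ∀ p ∈ B, 0 ≤ formAt O (-σ) (-σ * r) p) :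
    ¬ (convexHull ℝ (A ∪ C) ∩ convexHull ℝ (C ∪ B) ∩ convexHull ℝ (B ∪ A)).Nonempty := by
  rintro ⟨x, ⟨h₁, h₂⟩, h₃⟩
  -- Each hull lies in a half-plane. The first two forms add up to s - r < 0 times the third, so the
  -- three half-planes have no common point.
  have e₁ : 0 ≤ formAt O _ _ x := convexHull_min (Set.union_subset hA' hC) (convex_formAt_nonneg O _ _) h₁
  have e₂ : 0 ≤ formAt O _ _ x := convexHull_min (Set.union_subset hC' hB') (convex_formAt_nonneg O _ _) h₂
  have e₃ : 0 < formAt O _ _ x := convexHull_min (Set.union_subset hB hA) (convex_formAt_pos O _ _) h₃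
  simp only [formAt] at e₁ e₂ e₃
  have := mul_pos (sub_pos.2 hsr) e₃
  linarith

/-- The parameter `t` for which the line `formAt O 1 t = 0` passes through `p`. -/
noncomputable def slopeAt (O p : Plane) : ℝ := -(p 0 - O 0) / (p 1 - O 1)

/-- Turns the side of a line through O into a comparison of parameters; σ = ±1 treats U and L alike.
-/
theorem formAt_eq_mul_sub_slopeAt (O : Plane) (σ t : ℝ) {p : Plane} (hp : p 1 - O 1 ≠ 0) :
    formAt O σ (σ * t) p = formAt O 0 σ p * (t - slopeAt O p) := by
  simp only [formAt, slopeAt]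
  field_simp
  ring

theorem exists_slopeAt_bounds (O : Plane) {s : Set Plane} (hs : IsCompact s) (hne : s.Nonempty)
    (h0 : ∀ p ∈ s, p 1 - O 1 ≠ 0) :
    ∃ p ∈ s, ∃ q ∈ s, ∀ z ∈ s, slopeAt O p ≤ slopeAt O z ∧ slopeAt O z ≤ slopeAt O q := by
  have hc : ContinuousOn (slopeAt O) s := by
    unfold slopeAt
    exact ContinuousOn.div (by fun_prop) (by fun_prop) h0
  obtain ⟨p, hp, hpm⟩ := hs.exists_isMinOn hne hc
  obtain ⟨q, hq, hqm⟩ := hs.exists_isMaxOn hne hc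
  exact ⟨p, hp, q, hq, fun z hz => ⟨hpm hz, hqm hz⟩⟩

/-! ### From tight families to intervals -/

open Finset in
/-- In a tight family of `n` compact convex sets some line meets at least `n / 8` members. -/
theorem exists_isLine_of_compact_tightFamily {ι : Type*} [Fintype ι] (K : ι → Set Plane)
    (hconv : ∀ i, Convex ℝ (K i)) (hne : ∀ i, (K i).Nonempty) (hcomp : ∀ i, IsCompact (K i))
    (hK : TightFamily K) :
    ∃ l : AffineSubspace ℝ Plane, IsLine l ∧
      Fintype.card ι ≤ 8 * {i : ι | IsTransversal l (K i)}.ncard := by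
  classical
  by_contra! hcon
  obtain ⟨O, hO⟩ := exists_mem_convexHull_of_majority K hne hK
  -- A majority in the open half-plane would force the form to be positive at O, where it vanishes.
  have side : ∀ (a b : ℝ) (G : Finset ι), (∀ i ∈ G, ∀ p ∈ K i, 0 < formAt O a b p) →
      2 * #G ≤ Fintype.card ι := by
    intro a b G hG
    by_contra! h
    have : 0 < formAt O a b O := convexHull_min (Set.iUnion₂_subset hG) (convex_formAt_pos O a b) (hO G h)
    simp [formAt] at this
  have hit : ∀ (a b : ℝ) (G : Finset ι), a ≠ 0 ∨ b ≠ 0 →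
      (∀ i ∈ G, ∃ z ∈ K i, formAt O a b z = 0) → 8 * #G < Fintype.card ι := by
    intro a b G hab hG
    obtain ⟨l, hl, hmem⟩ := exists_isLine_of_formAt O a b hab
    refine lt_of_le_of_lt (Nat.mul_le_mul_left 8 ?_) (hcon l hl)
    rw [← Set.ncard_coe_finset]
    refine Set.ncard_le_ncard (fun i hi => ?_) (Set.toFinite _)
    obtain ⟨z, hz, h0⟩ := hG i hi
    exact ⟨z, hmem z h0, hz⟩
  set U : Finset ι := {i | ∀ p ∈ K i, 0 < formAt O 0 1 p} with hUdef
  set L : Finset ι := {i | ∀ p ∈ K i, 0 < formAt O 0 (-1) p} with hLdef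
  have memU : ∀ i ∈ U, ∀ p ∈ K i, 0 < formAt O 0 1 p := fun i hi => (mem_filter.1 hi).2
  have memL : ∀ i ∈ L, ∀ p ∈ K i, 0 < formAt O 0 (-1) p := fun i hi => (mem_filter.1 hi).2
  have hdisj : Disjoint U L := by
    rw [disjoint_left]
    intro i hi hi'
    obtain ⟨p, hp⟩ := hne i
    have h₁ := memU i hi p hp
    have h₂ := memL i hi' p hp
    simp only [formAt] at h₁ h₂
    linarith
  have hne0 : ∀ i ∈ U ∪ L, ∀ p ∈ K i, p 1 - O 1 ≠ 0 := by
    intro i hi p hp h0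
    rcases mem_union.1 hi with hi | hi
    · have := memU i hi p hp
      simp [formAt, h0] at this
    · have := memL i hi p hp
      simp [formAt, h0] at this
  -- Outside U and L the endpoints are arbitrary and never enter the count.
  have ends : ∀ i, ∃ p ∈ K i, ∃ q ∈ K i, i ∈ U ∪ L →
      ∀ z ∈ K i, slopeAt O p ≤ slopeAt O z ∧ slopeAt O z ≤ slopeAt O q := by
    intro i
    by_cases hi : i ∈ U ∪ L
    · obtain ⟨p, hp, q, hq, h⟩ := exists_slopeAt_bounds O (hcomp i) (hne i) (hne0 i hi)
      exact ⟨p, hp, q, hq, fun _ => h⟩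
    · obtain ⟨p, hp⟩ := hne i
      exact ⟨p, hp, p, hp, fun h => (hi h).elim⟩
  choose p hp q hq hpq using ends
  have inU : ∀ i ∈ U, i ∈ U ∪ L := fun i hi => mem_union_left _ hi
  have inL : ∀ i ∈ L, i ∈ U ∪ L := fun i hi => mem_union_right _ hi
  have formUL : ∀ (σ t : ℝ), ∀ i ∈ U ∪ L, ∀ z ∈ K i,
      formAt O σ (σ * t) z = formAt O 0 σ z * (t - slopeAt O z) := fun σ t i hi z hz =>
    formAt_eq_mul_sub_slopeAt O σ t (hne0 i hi z hz)
  have flip : ∀ (σ : ℝ) (z : Plane), formAt O 0 (-σ) z = -formAt O 0 σ z := by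
    intro σ z
    simp [formAt]
  have meets : ∀ (t : ℝ), ∀ i ∈ U ∪ L, slopeAt O (p i) ≤ t → t ≤ slopeAt O (q i) →
      ∃ z ∈ K i, formAt O 1 (1 * t) z = 0 := by
    intro t i hi h₁ h₂
    have ep' := formUL 1 t i hi _ (hp i)
    have eq' := formUL 1 t i hi _ (hq i)
    rcases mem_union.1 hi with hi' | hi'
    · refine exists_formAt_eq_zero O _ _ (hconv i) (hp i) (hq i) ?_ ?_
      · rw [ep']
        exact mul_nonneg (memU i hi' _ (hp i)).le (sub_nonneg.2 h₁)
      · rw [eq']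
        exact mul_nonpos_of_nonneg_of_nonpos (memU i hi' _ (hq i)).le (sub_nonpos.2 h₂)
    · have sp := memL i hi' _ (hp i)
      have sq := memL i hi' _ (hq i)
      rw [flip] at sp sq
      refine exists_formAt_eq_zero O _ _ (hconv i) (hq i) (hp i) ?_ ?_
      · rw [eq']
        exact mul_nonneg_of_nonpos_of_nonpos (by linarith) (sub_nonpos.2 h₂)
      · rw [ep']
        exact mul_nonpos_of_nonpos_of_nonneg (by linarith) (sub_nonneg.2 h₁)
  have sector : ∀ (σ : ℝ) (a b c : ι), a ∈ U ∪ L → b ∈ U ∪ L → c ∈ U ∪ L →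
      (∀ z ∈ K a, 0 < formAt O 0 σ z) → (∀ z ∈ K b, 0 < formAt O 0 σ z) →
      (∀ z ∈ K c, 0 < formAt O 0 (-σ) z) → slopeAt O (q a) < slopeAt O (p c) →
      slopeAt O (q c) < slopeAt O (p b) → False := by
    intro σ a b c ha hb hc sa sb sc hac hcb
    have hcc := hpq c hc _ (hp c)
    refine not_tight_of_alternate_sectors O σ (slopeAt O (q a)) (slopeAt O (p b)) (by linarith)
      (K a) (K b) (K c) sa sb (fun z hz => ?_) (fun z hz => ?_) (fun z hz => ?_) (fun z hz => ?_)
      (hK a c b ?_ ?_ ?_)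
    · rw [formUL _ _ a ha z hz]
      exact mul_nonneg (sa z hz).le (sub_nonneg.2 (hpq a ha z hz).2)
    · have h := sc z hz
      rw [flip] at h
      rw [formUL _ _ c hc z hz]
      exact mul_nonneg_of_nonpos_of_nonpos (by linarith) (by linarith [(hpq c hc z hz).1])
    · rw [formUL _ _ c hc z hz]
      exact mul_nonneg (sc z hz).le (by linarith [(hpq c hc z hz).2])
    · have h := sb z hz
      rw [formUL _ _ b hb z hz, flip]
      exact mul_nonneg_of_nonpos_of_nonpos (by linarith) (by linarith [(hpq b hb z hz).1])
    · rintro rfl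
      linarith
    · rintro rfl
      linarith [hpq c hc _ (hp c)]
    · rintro rfl
      linarith [hpq b hb _ (hp b)]
  have cardUL : ∀ (P Q : ι → Prop) [DecidablePred P] [DecidablePred Q],
      #{i ∈ U | P i} + #{i ∈ L | Q i} =
      #({i ∈ U | P i} ∪ {i ∈ L | Q i}) := fun P Q _ _ =>
    (card_union_of_disjoint (disjoint_filter_filter hdisj)).symm
  refine intervals_two_sides_false (Fintype.card ι) U L (fun i => slopeAt O (p i))
    (fun i => slopeAt O (q i)) (fun i hi => (hpq i hi _ (hp i)).2) (side 0 1 U memU)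
    (side 0 (-1) L memL) ?_ (fun t => ?_) (fun t => ?_) (fun t => ?_)
    (fun a ha c hc b hb => sector 1 a b c (inU a ha) (inU b hb) (inL c hc) (memU a ha)
      (memU b hb) (memL c hc))
    (fun a ha c hc b hb => sector (-1) a b c (inL a ha) (inL b hb) (inU c hc) (memL a ha)
      (memL b hb) (by simpa using memU c hc))
  -- A member in neither family has points weakly on both sides of the horizontal line, hence meets
  -- it.
  · have h := hit 0 1 (U ∪ L)ᶜ (Or.inr one_ne_zero) fun i hi => by
      rw [mem_compl, mem_union, not_or, hUdef, hLdef, mem_filter, mem_filter] at hi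
      simp only [mem_univ, true_and, flip] at hi
      push Not at hi
      obtain ⟨⟨x, hx, hx0⟩, y, hy, hy0⟩ := hi
      exact exists_formAt_eq_zero O _ _ (hconv i) hy hx (by linarith) hx0
    rw [card_compl, card_union_of_disjoint hdisj] at h
    omega
  · rw [cardUL]
    refine side 1 (1 * t) _ fun i hi z hz => ?_
    rcases mem_union.1 hi with hi | hi <;> rw [mem_filter] at hi
    · rw [formUL _ _ i (inU i hi.1) z hz]
      exact mul_pos (memU i hi.1 z hz) (by linarith [(hpq i (inU i hi.1) z hz).2])
    · have h := memL i hi.1 z hz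
      rw [flip] at h
      rw [formUL _ _ i (inL i hi.1) z hz]
      exact mul_pos_of_neg_of_neg (by linarith) (by linarith [(hpq i (inL i hi.1) z hz).1])
  · rw [cardUL]
    refine side (-1) (-1 * t) _ fun i hi z hz => ?_
    rcases mem_union.1 hi with hi | hi <;> rw [mem_filter] at hi
    · have h := memU i hi.1 z hz
      rw [formUL _ _ i (inU i hi.1) z hz, flip]
      exact mul_pos_of_neg_of_neg (by linarith) (by linarith [(hpq i (inU i hi.1) z hz).1])
    · rw [formUL _ _ i (inL i hi.1) z hz]
      exact mul_pos (memL i hi.1 z hz) (by linarith [(hpq i (inL i hi.1) z hz).2])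
  · rw [cardUL]
    refine hit 1 (1 * t) _ (Or.inl one_ne_zero) fun i hi => ?_
    rcases mem_union.1 hi with hi | hi <;> rw [mem_filter] at hi
    · exact meets t i (inU i hi.1) hi.2.1 hi.2.2
    · exact meets t i (inL i hi.1) hi.2.1 hi.2.2

theorem mainTheorem9 {ι : Type*} [Fintype ι] (F : ι → Set Plane)
    (hconv : ∀ i, Convex ℝ (F i)) (hne : ∀ i, (F i).Nonempty)
    (htight : ∀ i j k : ι, i ≠ j → j ≠ k → k ≠ i →
      (convexHull ℝ (F i ∪ F j) ∩ convexHull ℝ (F j ∪ F k) ∩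
        convexHull ℝ (F k ∪ F i)).Nonempty) :
    ∃ l : AffineSubspace ℝ Plane, IsLine l ∧
      (1 / 8 : ℝ) * (Fintype.card ι : ℝ) ≤ ({i : ι | IsTransversal l (F i)}.ncard : ℝ) := by
  obtain ⟨K, hKF, hKconv, hKne, hKcomp, hK⟩ := exists_compact_tightFamily F hconv hne htight
  obtain ⟨l, hl, hcard⟩ := exists_isLine_of_compact_tightFamily K hKconv hKne hKcomp hK
  refine ⟨l, hl, ?_⟩
  have hle : {i : ι | IsTransversal l (K i)}.ncard ≤ {i : ι | IsTransversal l (F i)}.ncard :=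
    Set.ncard_le_ncard (fun i hi => Set.Nonempty.mono (Set.inter_subset_inter_right _ (hKF i)) hi)
      (Set.toFinite _)
  have h : (Fintype.card ι : ℝ) ≤ 8 * ({i : ι | IsTransversal l (F i)}.ncard : ℝ) := by
    exact_mod_cast hcard.trans (Nat.mul_le_mul_left 8 hle)
  linarith
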